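/- Let $g\ge 1$ be an integer and let $C=(C_{-1},C_0,\dots,C_g)\in\mathbb{R}^{g+2}$ satisfy $C_{-1}>2C_0$, $C_i+C_{i+2}>2C_{i+1}$ for $0\le i\le g-2$, and $C_{g-1}>2C_g$. Put $$L=C_{-1}-2(g+1)C_g,\quad \lambda_0=C_g,\quad \lambda_i=C_{g-i}-C_{g-i+1}\ (1\le i\le g),\quad \vec\lambda=(\lambda_1-\lambda_0,\lambda_2-\lambda_1,\dots,\lambda_g-\lambda_{g-1}),$$ $$p_0=L,\qquad p_i=L-2\sum_{j=1}^g\min[\lambda_i-\lambda_0,\lambda_j-\lambda_0]\quad(1\le i\le g),$$ and let $K$ be the symmetric tridiagonal (positive definite) $g\times g$ matrix with $K_{ii}=p_{i-1}+p_i+2(\lambda_i-\lambda_{i-1})$ and $K_{i,i+1}=K_{i+1,i}=-p_i$. Let $$\Theta(\mathbf Z)=\min_{\mathbf m\in\mathbb{Z}^g}\Bigl[\tfrac12\,\mathbf m K\mathbf m^{\top}+\mathbf m\mathbf Z^{\top}\Bigr]\quad(\mathbf Z\in\mathbb{R}^g),\qquad J(K)=\mathbb{R}^g/\mathbb{Z}^gK,\qquad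 \mathbf e_1=(1,0,\dots,0)\in\mathbb{R}^g.$$ For $t\in\mathbb{Z}$ let $\mathcal S_t\times\mathcal S_{t+1}$ be the set of pairs of real sequences $(T_n^t,T_n^{t+1})_{n\in\mathbb{Z}}$ for which there are $a,b,c\in\mathbb{R}$ with $T^s_{n+g+1}=T^s_n+an+bs+c$ for all $n\in\mathbb{Z}$ and $s\in\{t,t+1\}$. Call two such pairs $T,T'$ equivalent, $T\sim T'$, if there are $\alpha,\beta,\gamma\in\mathbb{R}$ with $T'^s_n=T^s_n+\alpha n+\beta s+\gamma$ for all $n\in\mathbb{Z}$ and $s\in\{t,t+1\}$. Define $$\iota_t(\mathbf Z_0)=\bigl(\Theta(\mathbf Z_0-nL\mathbf e_1+t\vec\lambda),\ \Theta(\mathbf Z_0-nL\mathbf e_1+(t+1)\vec\lambda)\bigr)_{n\in\mathbb{Z}}\qquad(\mathbf Z_0\in\mathbb{R}^g).$$ Then, for every $t\in\mathbb{Z}$, $\iota_t$ maps $\mathbb{R}^g$ into $\mathcal S_t\times\mathcal S_{t+1}$ and is injective up to the period lattice: if $\iota_t(\mathbf Z)=\iota_t(\mathbf Z')$, then $\mathbf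 Z-\mathbf Z'\in\mathbb{Z}^gK$. More precisely, $\iota_t$ induces a well-defined injective map $J(K)\to(\mathcal S_t\times\mathcal S_{t+1})/\!\sim$; that is, for all $\mathbf Z,\mathbf Z'\in\mathbb{R}^g$, $$\iota_t(\mathbf Z)\sim\iota_t(\mathbf Z')\iff \mathbf Z-\mathbf Z'\in\mathbb{Z}^gK .$$ -/

import Mathlib

namespace UDToda

open Matrix Finset

/-! A level `C = (C_{-1}, C_0, ..., C_g)` is written as a function `C : ℤ → ℝ`; only its
entries with index between `-1` and `g` are ever used. Vectors of `ℝ^g` are row vectors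
`Fin g → ℝ`; the coordinate that is numbered `i` (with `1 ≤ i ≤ g`) on paper is the one at
`i - 1 : Fin g`. -/

/-- The generic condition on `C`. -/
def Generic (g : ℕ) (C : ℤ → ℝ) : Prop :=
  C (-1) > 2 * C 0 ∧
  (∀ i : ℤ, 0 ≤ i → i ≤ (g : ℤ) - 2 → C i + C (i + 2) > 2 * C (i + 1)) ∧
  C ((g : ℤ) - 1) > 2 * C (g : ℤ)

/-- `L = C_{-1} - 2 (g + 1) C_g`. -/
def bigL (g : ℕ) (C : ℤ → ℝ) : ℝ := C (-1) - 2 * ((g : ℝ) + 1) * C (g : ℤ)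

/-- `λ_0 = C_g` and `λ_i = C_{g - i} - C_{g - i + 1}` for `1 ≤ i ≤ g`. -/
def lam (g : ℕ) (C : ℤ → ℝ) (i : ℕ) : ℝ :=
  if i = 0 then C (g : ℤ) else C ((g : ℤ) - i) - C ((g : ℤ) - i + 1)

/-- `p_0 = L` and `p_i = L - 2 ∑_{j=1}^g min (λ_i - λ_0, λ_j - λ_0)` for `1 ≤ i ≤ g`. -/
noncomputable def pcoef (g : ℕ) (C : ℤ → ℝ) (i : ℕ) : ℝ :=
  if i = 0 then bigL g C
  else bigL g C - 2 * ∑ j ∈ Finset.Icc 1 g, min (lam g C i - lam g C 0) (lam g C j - lam g C 0)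

/-- The vector `(λ_1 - λ_0, λ_2 - λ_1, ..., λ_g - λ_{g-1})`. -/
def lamVec (g : ℕ) (C : ℤ → ℝ) : Fin g → ℝ :=
  fun i => lam g C ((i : ℕ) + 1) - lam g C (i : ℕ)

/-- The tridiagonal period matrix `K`, with diagonal entries
`p_{i-1} + p_i + 2 (λ_i - λ_{i-1})` and `K_{i,i+1} = K_{i+1,i} = - p_i` (numbering from `1`). -/
noncomputable def periodMatrix (g : ℕ) (C : ℤ → ℝ) : Matrix (Fin g) (Fin g) ℝ :=
  fun i j =>
    if i = j then
      pcoef g C (i : ℕ) + pcoef g C ((i : ℕ) + 1)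
        + 2 * (lam g C ((i : ℕ) + 1) - lam g C (i : ℕ))
    else if (j : ℕ) = (i : ℕ) + 1 then - pcoef g C ((i : ℕ) + 1)
    else if (i : ℕ) = (j : ℕ) + 1 then - pcoef g C ((j : ℕ) + 1)
    else 0

/-- An integer vector as a real vector. -/
def intVec {g : ℕ} (m : Fin g → ℤ) : Fin g → ℝ := fun i => (m i : ℝ)

/-- The tropical Riemann theta function
`Θ(Z; K) = min_{m ∈ ℤ^g} (1/2 m K mᵀ + m Zᵀ)`. For a positive definite `K` the infimum
is finite and attained. -/
noncomputable def theta {g : ℕ} (K : Matrix (Fin g) (Fin g) ℝ) (Z : Fin g → ℝ) : ℝ :=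
  ⨅ m : Fin g → ℤ, ((1 / 2 : ℝ) * (intVec m ⬝ᵥ (K *ᵥ intVec m)) + intVec m ⬝ᵥ Z)

/-- The period lattice `ℤ^g K`. -/
def periodLattice {g : ℕ} (K : Matrix (Fin g) (Fin g) ℝ) : AddSubgroup (Fin g → ℝ) where
  carrier := {v | ∃ l : Fin g → ℤ, v = intVec l ᵥ* K}
  zero_mem' := ⟨0, by
    have h : intVec (0 : Fin g → ℤ) = 0 := by ext i; simp [intVec]
    rw [h, Matrix.zero_vecMul]⟩
  add_mem' := by
    rintro _ _ ⟨l, rfl⟩ ⟨l', rfl⟩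
    refine ⟨l + l', ?_⟩
    have h : intVec (l + l') = intVec l + intVec l' := by ext i; simp [intVec]
    rw [h, Matrix.add_vecMul]
  neg_mem' := by
    rintro _ ⟨l, rfl⟩
    refine ⟨-l, ?_⟩
    have h : intVec (-l) = -intVec l := by ext i; simp [intVec]
    rw [h, Matrix.neg_vecMul]

/-- The tropical Jacobian `J(K) = ℝ^g / ℤ^g K`. -/
abbrev TropicalJacobian {g : ℕ} (K : Matrix (Fin g) (Fin g) ℝ) : Type :=
  (Fin g → ℝ) ⧸ periodLattice K

/-- The space `𝒮_t × 𝒮_{t+1}` of pairs `(T_n^t, T_n^{t+1})_{n ∈ ℤ}` of real sequences with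
`T_{n+g+1}^s = T_n^s + (a n + b s + c)` for `s = t, t + 1` and some real `a, b, c`. -/
def tauPairs (g : ℕ) (t : ℤ) : Set ((ℤ → ℝ) × (ℤ → ℝ)) :=
  {T | ∃ a b c : ℝ, ∀ n : ℤ,
    T.1 (n + (g : ℤ) + 1) = T.1 n + (a * (n : ℝ) + b * (t : ℝ) + c) ∧
    T.2 (n + (g : ℤ) + 1) = T.2 n + (a * (n : ℝ) + b * ((t : ℝ) + 1) + c)}

/-- Two pairs of sequences are identified if they differ by an affine function
`α n + β s + γ` of `(n, s)`, `s = t, t + 1`. (Translating `Z_0` by the period lattice changes the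
theta values by such a function.) -/
def AffineEquivalent (t : ℤ) (T T' : (ℤ → ℝ) × (ℤ → ℝ)) : Prop :=
  ∃ α β γ : ℝ, ∀ n : ℤ,
    T'.1 n = T.1 n + (α * (n : ℝ) + β * (t : ℝ) + γ) ∧
    T'.2 n = T.2 n + (α * (n : ℝ) + β * ((t : ℝ) + 1) + γ)

/-- The point `Z_n^s = Z_0 - n L e_1 + s λ⃗`. -/
noncomputable def zPoint (g : ℕ) (C : ℤ → ℝ) (Z₀ : Fin g → ℝ) (n s : ℤ) : Fin g → ℝ :=
  fun i => Z₀ i - (if (i : ℕ) = 0 then (n : ℝ) * bigL g C else 0) + (s : ℝ) * lamVec g C i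

/-- The map `ι_t`, sending `Z_0` to
`(Θ(Z_0 - n L e_1 + t λ⃗), Θ(Z_0 - n L e_1 + (t + 1) λ⃗))_{n ∈ ℤ}`. -/
noncomputable def iota (g : ℕ) (C : ℤ → ℝ) (t : ℤ) (Z₀ : Fin g → ℝ) : (ℤ → ℝ) × (ℤ → ℝ) :=
  (fun n => theta (periodMatrix g C) (zPoint g C Z₀ n t),
   fun n => theta (periodMatrix g C) (zPoint g C Z₀ n (t + 1)))

end UDToda

namespace UDToda

open Matrix Finset

/-! Up to the term `p 0 / 2 * n ^ 2`, the number `Θ(Z_0 - nL e_1 + s λ⃗)` is the least energy of a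
chain of integers with left end `n` and right end `0`: expanding the couplings and potentials gives
exactly the tridiagonal form `K` (`theta_eq_chainMin`). Since the diagonal excess of `K` is twice
the vector `λ⃗`, passing from `s` to `s + 1` replaces the linear potential `w` by `w + μ`
(`theta_zPoint`).

The chain minimum is built by alternately adding a potential and taking the infimal convolution with
a parabola. For convex functions the latter merges the slopes with the progression `p * (k + 1/2)`,
so it adds counting functions (`infConv_galoisConnection`). The two times are needed to undo the
merge: without the progression their slopes interlace strictly (`interlace_chainMin`,
`addPotential_strict`) and have no common value, whereas the progression is common to both. Hence it
can be located and cancelled (`unmerge`). Induction on the number of sites recovers `w` up to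
integer index shifts, and these shifts are the coordinates of a lattice vector
(`exists_lattice_of_slopes`). An affine change of the sequences only adds a constant to the slopes,
so injectivity holds modulo affine functions.

Conversely, translation by the lattice changes `Θ` by an affine function of `(n, s)`
(`theta_add_lattice`). Membership in the space of pairs is a special case, since `(g, g-1, …, 1) K =
(g+1) L e_1` (`vecMul_descending`). -/

/-! ### Slopes of functions on `ℤ` and infimal convolution

The slopes `a k = f (k + 1) - f k` of a convex coercive function `f : ℤ → ℝ` are described by
their counting function `N : ℝ → ℤ`, the lower adjoint of `a`. Infimal convolution adds counting
functions. -/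

/-- The increment `f (k + 1) - f k`. -/
def slope (f : ℤ → ℝ) (k : ℤ) : ℝ := f (k + 1) - f k

theorem exists_galoisConnection {a : ℤ → ℝ} (ha : Monotone a) (top : ∀ x, ∃ k, x ≤ a k)
    (bot : ∀ x, ∃ k, a k < x) : ∃ N : ℝ → ℤ, GaloisConnection N a := by
  have key : ∀ x, ∃ n : ℤ, ∀ k, n ≤ k ↔ x ≤ a k := by
    intro x
    obtain ⟨b, hb⟩ := bot x
    obtain ⟨n, hn, hmin⟩ := Int.exists_least_of_bdd (P := fun k => x ≤ a k)
      ⟨b, fun z hz => by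
        by_contra h
        exact absurd (hz.trans (ha (not_le.mp h).le)) (not_le.mpr hb)⟩ (top x)
    exact ⟨n, fun k => ⟨fun h => hn.trans (ha h), hmin k⟩⟩
  choose N hN using key
  exact ⟨N, fun x k => hN x k⟩

theorem slope_lt_of_lt {a : ℤ → ℝ} {N : ℝ → ℤ} (h : GaloisConnection N a) {x : ℝ} {k : ℤ}
    (hk : k < N x) : a k < x := by
  by_contra hx
  exact absurd ((h x k).2 (not_lt.mp hx)) (not_le.mpr hk)

theorem eq_of_galoisConnection {a b : ℤ → ℝ} {N : ℝ → ℤ} (ha : GaloisConnection N a)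
    (hb : GaloisConnection N b) (k : ℤ) : a k = b k :=
  le_antisymm ((hb _ _).1 ((ha _ _).2 le_rfl)) ((ha _ _).1 ((hb _ _).2 le_rfl))

theorem le_of_slope_sign {f : ℤ → ℝ} {m₀ : ℤ} (hlo : ∀ m < m₀, slope f m ≤ 0)
    (hhi : ∀ m, m₀ ≤ m → 0 ≤ slope f m) (m : ℤ) : f m₀ ≤ f m := by
  rcases le_total m₀ m with h | h
  · induction m, h using Int.leInduction with
    | base => exact le_rfl
    | succ n hn ih =>
      have := hhi n hn
      unfold slope at this
      linarith
  · induction m, h using Int.leInductionDown with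
    | base => exact le_rfl
    | pred n hn ih =>
      have := hlo (n - 1) (by omega)
      unfold slope at this
      rw [sub_add_cancel] at this
      linarith

/-- The infimal convolution of two functions on `ℤ`. -/
noncomputable def infConv (q h : ℤ → ℝ) (n : ℤ) : ℝ := ⨅ m : ℤ, (q (n - m) + h m)

/-- The summand is convex in `m` and its slopes change sign, so the infimum is attained; this
excludes the default value of an unbounded real infimum and supplies minimisers. -/
theorem infConv_isLeast {q h : ℤ → ℝ} {D N : ℝ → ℤ} (hq : GaloisConnection D (slope q))
    (hh : GaloisConnection N (slope h)) (n : ℤ) :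
    IsLeast (Set.range fun m : ℤ => q (n - m) + h m) (infConv q h n) := by
  have hs : ∀ m, slope (fun m => q (n - m) + h m) m = slope h m - slope q (n - m - 1) := by
    intro m
    simp only [slope]
    rw [show n - m - 1 + 1 = n - m by ring, show n - (m + 1) = n - m - 1 by ring]
    ring
  have hmono : Monotone (slope fun m => q (n - m) + h m) := by
    intro x y hxy
    rw [hs, hs]
    have := hh.monotone_u hxy
    have := hq.monotone_u (show n - y - 1 ≤ n - x - 1 by omega)
    linarith
  have hP : ∃ m₀ : ℤ, ∀ m, m₀ ≤ m ↔ 0 ≤ slope (fun m => q (n - m) + h m) m := by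
    have hbdd : ∃ b : ℤ, ∀ z : ℤ, 0 ≤ slope (fun m => q (n - m) + h m) z → b ≤ z := by
      refine ⟨min (N 0 - 1) (n - 1 - D 0), fun z hz => ?_⟩
      by_contra hlt
      rw [not_le, lt_min_iff] at hlt
      rw [hs] at hz
      have h1 := slope_lt_of_lt hh (x := 0) (k := z) (by omega)
      have h2 := (hq 0 (n - z - 1)).1 (by omega)
      linarith
    have hex : ∃ z : ℤ, 0 ≤ slope (fun m => q (n - m) + h m) z := by
      refine ⟨max (N 0) (n - D 0), ?_⟩
      rw [hs]
      have h1 := (hh 0 _).1 (le_max_left (N 0) (n - D 0))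
      have h2 := slope_lt_of_lt hq (x := 0) (k := n - max (N 0) (n - D 0) - 1)
        (by have := le_max_right (N 0) (n - D 0); omega)
      linarith
    obtain ⟨m₀, h₀, hmin⟩ := Int.exists_least_of_bdd hbdd hex
    exact ⟨m₀, fun m => ⟨fun hm => h₀.trans (hmono hm), hmin m⟩⟩
  obtain ⟨m₀, h₀⟩ := hP
  have hle := le_of_slope_sign (f := fun m => q (n - m) + h m) (m₀ := m₀)
    (fun m hm => (not_le.mp fun hc => absurd ((h₀ m).2 hc) (not_le.mpr hm)).le)
    (fun m hm => (h₀ m).1 hm)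
  have hleast : IsLeast (Set.range fun m : ℤ => q (n - m) + h m) (q (n - m₀) + h m₀) :=
    ⟨⟨m₀, rfl⟩, by rintro _ ⟨m, rfl⟩; exact hle m⟩
  have : infConv q h n = q (n - m₀) + h m₀ := hleast.csInf_eq
  rwa [this]

/-- Infimal convolution merges slopes. -/
theorem infConv_galoisConnection {q h : ℤ → ℝ} {D N : ℝ → ℤ}
    (hq : GaloisConnection D (slope q)) (hh : GaloisConnection N (slope h)) :
    GaloisConnection (fun x => N x + D x) (slope (infConv q h)) := by
  intro x n
  obtain ⟨⟨m₁, hm₁⟩, hle₁⟩ := infConv_isLeast hq hh (n + 1)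
  obtain ⟨⟨m₀, hm₀⟩, hle₀⟩ := infConv_isLeast hq hh n
  simp only at hm₁ hm₀
  constructor
  · intro hn
    -- A minimiser for `n + 1` has an `h`-part beyond `N x` or a `q`-part beyond `D x`; shortening
    -- that part by one step saves at least `x`.
    by_cases hm : N x < m₁
    · have h1 := (hh x (m₁ - 1)).1 (by omega)
      have h2 := hle₀ ⟨m₁ - 1, rfl⟩
      simp only [slope, sub_add_cancel] at h1 h2 ⊢
      rw [show n - (m₁ - 1) = n + 1 - m₁ by ring] at h2
      linarith
    · have h1 := (hq x (n - m₁)).1 (by simp only at hn; omega)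
      have h2 := hle₀ ⟨m₁, rfl⟩
      simp only [slope] at h1 h2 ⊢
      rw [show n - m₁ + 1 = n + 1 - m₁ by ring] at h1
      linarith
  · intro hx
    by_contra hn
    simp only [not_le] at hn
    -- Conversely, in a minimiser for `n` one of the parts is still short of its count, and
    -- lengthening it costs less than `x`.
    by_cases hm : m₀ < N x
    · have h1 := slope_lt_of_lt hh hm
      have h2 := hle₁ ⟨m₀ + 1, rfl⟩
      simp only [slope] at h1 h2 hx
      rw [show n + 1 - (m₀ + 1) = n - m₀ by ring] at h2
      linarith
    · have h1 := slope_lt_of_lt hq (x := x) (k := n - m₀) (by omega)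
      have h2 := hle₁ ⟨m₀, rfl⟩
      simp only [slope] at h1 h2 hx
      rw [show n - m₀ + 1 = n + 1 - m₀ by ring] at h1
      linarith

/-- If neither `b` nor `d` takes the value `a k`, then no slope is counted between `a k` and the
next larger value of either, so the merged sequence at `k` would already be larger than `a k`. -/
theorem range_subset_of_merge {a b d : ℤ → ℝ} {N D : ℝ → ℤ}
    (ha : GaloisConnection (fun x => N x + D x) a) (hb : GaloisConnection N b)
    (hd : GaloisConnection D d) (k : ℤ) : (∃ i, b i = a k) ∨ ∃ i, d i = a k := by
  by_contra! h
  have h1 : a k < b (N (a k)) := lt_of_le_of_ne (hb.le_u_l _) (h.1 _).symm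
  have h2 : a k < d (D (a k)) := lt_of_le_of_ne (hd.le_u_l _) (h.2 _).symm
  have h3 := (hb _ _).2 (min_le_left (b (N (a k))) (d (D (a k))))
  have h4 := (hd _ _).2 (min_le_right (b (N (a k))) (d (D (a k))))
  have h5 := (ha (a k) k).2 le_rfl
  have h6 := (ha (min (b (N (a k))) (d (D (a k)))) k).1 (by simp only at h5 ⊢; omega)
  exact absurd h6 (not_le.mpr (lt_min h1 h2))

/-- At the index where the two counts for `d k` add up, a merged value above `d k` would force `D`
past `k`, because `N` cannot decrease. -/
theorem exists_eq_of_merge {a b d : ℤ → ℝ} {N D : ℝ → ℤ}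
    (ha : GaloisConnection (fun x => N x + D x) a) (hb : GaloisConnection N b)
    (hd : GaloisConnection D d) (k : ℤ) : ∃ i, a i = d k := by
  refine ⟨N (d k) + D (d k), le_antisymm ?_ (ha.le_u_l _)⟩
  have hle := ha.le_u_l (d k)
  have h1 := (ha _ _).2 (le_refl (a (N (d k) + D (d k))))
  have h2 := hb.monotone_l hle
  have h3 := (hd (d k) k).2 le_rfl
  simp only at h1 h2
  exact (hd _ _).1 (by omega)

/-! ### The chain

`chainMin g p μ w n` is the least energy of a chain of integers `n = m_0, m_1, …, m_{g + 1} = 0`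
with couplings `p i / 2 * (m_i - m_{i+1}) ^ 2` and potentials `μ i * m ^ 2 + w i * m`. -/

/-- The quadratic function `p / 2 * k ^ 2` on `ℤ`. -/
noncomputable def quad (p : ℝ) (k : ℤ) : ℝ := p / 2 * (k : ℝ) ^ 2

/-- Adding the potential `μ * k ^ 2 + w * k`. -/
noncomputable def addPotential (μ w : ℝ) (f : ℤ → ℝ) (k : ℤ) : ℝ :=
  μ * (k : ℝ) ^ 2 + w * k + f k

/-- The least energy of a chain with `g` inner sites and left end `n`. -/
noncomputable def chainMin : (g : ℕ) → (ℕ → ℝ) → (ℕ → ℝ) → (Fin g → ℝ) → ℤ → ℝ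
  | 0, p, _, _ => quad (p 0)
  | g + 1, p, μ, w => infConv (quad (p 0))
      (addPotential (μ 0) (w 0)
        (chainMin g (fun i => p (i + 1)) (fun i => μ (i + 1)) (fun i => w i.succ)))

theorem slope_quad (p : ℝ) (k : ℤ) : slope (quad p) k = p * ((k : ℝ) + 1 / 2) := by
  simp only [slope, quad]
  push_cast
  ring

theorem slope_addPotential (μ w : ℝ) (f : ℤ → ℝ) (k : ℤ) :
    slope (addPotential μ w f) k = slope f k + μ * (2 * k + 1) + w := by
  simp only [slope, addPotential]
  push_cast
  ring

theorem exists_galoisConnection_quad {p : ℝ} (hp : 0 < p) :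
    ∃ D : ℝ → ℤ, GaloisConnection D (slope (quad p)) := by
  apply exists_galoisConnection
  · intro x y hxy
    rw [slope_quad, slope_quad]
    have : (x : ℝ) ≤ y := by exact_mod_cast hxy
    gcongr
  · intro x
    refine ⟨⌈x / p⌉, ?_⟩
    rw [slope_quad]
    have h1 := Int.le_ceil (x / p)
    rw [div_le_iff₀ hp] at h1
    nlinarith
  · intro x
    refine ⟨⌊x / p⌋ - 1, ?_⟩
    rw [slope_quad]
    have h1 := Int.floor_le (x / p)
    rw [le_div_iff₀ hp] at h1
    push_cast
    nlinarith

theorem exists_galoisConnection_addPotential {μ : ℝ} (hμ : 0 < μ) (w : ℝ) {f : ℤ → ℝ}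
    {N : ℝ → ℤ} (hf : GaloisConnection N (slope f)) :
    ∃ M : ℝ → ℤ, GaloisConnection M (slope (addPotential μ w f)) := by
  apply exists_galoisConnection
  · intro x y hxy
    rw [slope_addPotential, slope_addPotential]
    have h1 : (x : ℝ) ≤ y := by exact_mod_cast hxy
    have h2 := hf.monotone_u hxy
    gcongr
  · intro x
    refine ⟨max (N (x - w)) 0, ?_⟩
    rw [slope_addPotential]
    have h1 := (hf (x - w) _).1 (le_max_left (N (x - w)) 0)
    have h2 : (0 : ℝ) ≤ (max (N (x - w)) 0 : ℤ) := by exact_mod_cast le_max_right _ _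
    nlinarith
  · intro x
    refine ⟨min (N (x - w) - 1) (-1), ?_⟩
    rw [slope_addPotential]
    have h1 := slope_lt_of_lt hf (x := x - w) (k := min (N (x - w) - 1) (-1)) (by omega)
    have h2 : ((min (N (x - w) - 1) (-1) : ℤ) : ℝ) ≤ -1 := by
      exact_mod_cast min_le_right (N (x - w) - 1) (-1)
    nlinarith

theorem exists_galoisConnection_chainMin (g : ℕ) (p μ : ℕ → ℝ) (w : Fin g → ℝ)
    (hp : ∀ i ≤ g, 0 < p i) (hμ : ∀ i < g, 0 < μ i) :
    ∃ N : ℝ → ℤ, GaloisConnection N (slope (chainMin g p μ w)) := by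
  induction g generalizing p μ with
  | zero => exact exists_galoisConnection_quad (hp 0 le_rfl)
  | succ g ih =>
    obtain ⟨N, hN⟩ := ih (fun i => p (i + 1)) (fun i => μ (i + 1)) (fun i => w i.succ)
      (fun i hi => hp _ (by omega)) (fun i hi => hμ _ (by omega))
    obtain ⟨M, hM⟩ := exists_galoisConnection_addPotential (hμ 0 (by omega)) (w 0) hN
    obtain ⟨D, hD⟩ := exists_galoisConnection_quad (hp 0 (by omega))
    exact ⟨_, infConv_galoisConnection hD hM⟩

/-- Two sequences of slopes interlace weakly. -/
def Interlace (a a' : ℤ → ℝ) : Prop := ∀ k, a k ≤ a' k ∧ a' k ≤ a (k + 1)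

/-- Adding a positive potential and moving it by its own strength makes interlacing strict. -/
theorem addPotential_strict {μ : ℝ} (hμ : 0 < μ) (w : ℝ) {f f' : ℤ → ℝ}
    (h : Interlace (slope f) (slope f')) (k : ℤ) :
    slope (addPotential μ w f) k < slope (addPotential μ (w + μ) f') k ∧
      slope (addPotential μ (w + μ) f') k < slope (addPotential μ w f) (k + 1) := by
  simp only [slope_addPotential]
  push_cast
  -- The three added terms are `w` plus `μ` times `2k + 1`, `2k + 2`, `2k + 3`: moving `w` by `μ` is
  -- half an index step.
  constructor <;> nlinarith [(h k).1, (h k).2]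

/-- Interlacing amounts to `M' ≤ M ≤ M' + 1` for the counting functions, and this survives adding
the common count `D` of the progression. -/
theorem interlace_chainMin (g : ℕ) (p μ : ℕ → ℝ) (w : Fin g → ℝ)
    (hp : ∀ i ≤ g, 0 < p i) (hμ : ∀ i < g, 0 < μ i) :
    Interlace (slope (chainMin g p μ w)) (slope (chainMin g p μ fun i => w i + μ i)) := by
  induction g generalizing p μ with
  | zero =>
    obtain ⟨D, hD⟩ := exists_galoisConnection_quad (hp 0 le_rfl)
    exact fun k => ⟨le_rfl, hD.monotone_u (by omega)⟩
  | succ g ih =>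
    have hp' : ∀ i ≤ g, 0 < p (i + 1) := fun i hi => hp _ (by omega)
    have hμ' : ∀ i < g, 0 < μ (i + 1) := fun i hi => hμ _ (by omega)
    have hI := ih (fun i => p (i + 1)) (fun i => μ (i + 1)) (fun i => w i.succ) hp' hμ'
    have hs := addPotential_strict (hμ 0 (by omega)) (w 0) hI
    obtain ⟨N, hN⟩ := exists_galoisConnection_chainMin g (fun i => p (i + 1))
      (fun i => μ (i + 1)) (fun i => w i.succ) hp' hμ'
    obtain ⟨N', hN'⟩ := exists_galoisConnection_chainMin g (fun i => p (i + 1))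
      (fun i => μ (i + 1)) (fun i => w i.succ + μ (i + 1)) hp' hμ'
    obtain ⟨M, hM⟩ := exists_galoisConnection_addPotential (hμ 0 (by omega)) (w 0) hN
    obtain ⟨M', hM'⟩ :=
      exists_galoisConnection_addPotential (hμ 0 (by omega)) (w 0 + μ 0) hN'
    obtain ⟨D, hD⟩ := exists_galoisConnection_quad (hp 0 (by omega))
    have hA := infConv_galoisConnection hD hM
    have hA' := infConv_galoisConnection hD hM'
    have h1 : ∀ x, M' x ≤ M x := fun x =>
      (hM' _ _).2 ((hM.le_u_l x).trans (hs (M x)).1.le)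
    have h2 : ∀ x, M x ≤ M' x + 1 := fun x =>
      (hM _ _).2 ((hM'.le_u_l x).trans (hs (M' x)).2.le)
    intro k
    constructor
    · refine (hA' _ _).1 ?_
      have := (hA _ k).2 le_rfl
      have := h1 (slope (chainMin (g + 1) p μ w) k)
      simp only [chainMin] at *
      omega
    · refine (hA _ _).1 ?_
      have := (hA' _ k).2 le_rfl
      have := h2 (slope (chainMin (g + 1) p μ fun i => w i + μ i) k)
      simp only [chainMin, Fin.val_succ, Fin.val_zero] at *
      omega

/-- The progression that is merged in can be recovered, hence removed. Here `f, f'` interlace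
strictly, as do `h, h'`. -/
theorem unmerge {p c : ℝ} (hp : 0 < p) {j : ℤ} {f f' h h' : ℤ → ℝ} {N N' M M' : ℝ → ℤ}
    (hf : GaloisConnection N (slope f)) (hf' : GaloisConnection N' (slope f'))
    (hh : GaloisConnection M (slope h)) (hh' : GaloisConnection M' (slope h'))
    (hs : ∀ k, slope h k < slope h' k ∧ slope h' k < slope h (k + 1))
    (e : ∀ k, slope (infConv (quad p) h) k = slope (infConv (quad p) f) (k + j) + c)
    (e' : ∀ k, slope (infConv (quad p) h') k = slope (infConv (quad p) f') (k + j) + c) :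
    ∃ r : ℤ, c = r * p ∧ (∀ k, slope h k = slope f (k + (j + r)) + c) ∧
      ∀ k, slope h' k = slope f' (k + (j + r)) + c := by
  obtain ⟨D, hD⟩ := exists_galoisConnection_quad hp
  have gf := infConv_galoisConnection hD hf
  have gf' := infConv_galoisConnection hD hf'
  have gh := infConv_galoisConnection hD hh
  have gh' := infConv_galoisConnection hD hh'
  -- The progression term of index `0` is a slope at both times, so its translate by `c` is a slope
  -- of both `h`-convolutions. It cannot come from both `h` and `h'`, hence it is again a term of
  -- the progression.
  have hr : ∃ r : ℤ, c = r * p := by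
    obtain ⟨i, hi⟩ := exists_eq_of_merge gf hf hD 0
    obtain ⟨i', hi'⟩ := exists_eq_of_merge gf' hf' hD 0
    have ei := e (i - j)
    have ei' := e' (i' - j)
    rw [sub_add_cancel, hi] at ei
    rw [sub_add_cancel, hi'] at ei'
    have hd : ∃ k, slope (quad p) k = slope (quad p) 0 + c := by
      rcases range_subset_of_merge gh hh hD (i - j) with ⟨k, hk⟩ | ⟨k, hk⟩
      · rcases range_subset_of_merge gh' hh' hD (i' - j) with ⟨k', hk'⟩ | ⟨k', hk'⟩
        · exfalso
          have hkk : slope h k = slope h' k' := by rw [hk, hk', ei, ei']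
          rcases le_or_gt k k' with hle | hlt
          · have := hh'.monotone_u hle
            have := (hs k).1
            linarith
          · have := hh.monotone_u (show k' + 1 ≤ k by omega)
            have := (hs k').2
            linarith
        · exact ⟨k', hk'.trans ei'⟩
      · exact ⟨k, hk.trans ei⟩
    obtain ⟨k, hk⟩ := hd
    rw [slope_quad, slope_quad] at hk
    exact ⟨k, by push_cast at hk; linarith⟩
  obtain ⟨r, hr⟩ := hr
  refine ⟨r, hr, ?_⟩
  -- Translation by `r * p` maps the progression to itself with index shift `r`, so `D` cancels from
  -- the two counts up to `r`.
  have hDr : ∀ x, D (x - c) = D x - r := by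
    have hiff : ∀ x k, D (x - c) ≤ k ↔ D x - r ≤ k := by
      intro x k
      rw [hD (x - c) k, sub_le_iff_le_add (a := D x), hD x (k + r), slope_quad, slope_quad, hr]
      push_cast
      constructor <;> intro _ <;> linarith
    exact fun x => le_antisymm ((hiff _ _).2 le_rfl) ((hiff _ _).1 le_rfl)
  have key : ∀ {u v : ℤ → ℝ} {U V : ℝ → ℤ}, GaloisConnection U (slope u) →
      GaloisConnection V (slope v) →
      (∀ k, slope (infConv (quad p) v) k = slope (infConv (quad p) u) (k + j) + c) →
      ∀ k, slope v k = slope u (k + (j + r)) + c := by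
    intro u v U V hu hv huv
    have gu := infConv_galoisConnection hD hu
    have gv := infConv_galoisConnection hD hv
    have hiff : ∀ x k, V x + D x ≤ k ↔ U (x - c) + D (x - c) ≤ k + j := by
      intro x k
      have h1 := gv x k
      have h2 := gu (x - c) (k + j)
      simp only at h1 h2
      rw [h1, h2, huv, sub_le_iff_le_add]
    have hV : ∀ x, V x = U (x - c) - (j + r) := by
      intro x
      have h1 := (hiff x _).1 le_rfl
      have h2 := (hiff x (U (x - c) + D (x - c) - j)).2 (by omega)
      have := hDr x
      omega
    refine eq_of_galoisConnection (b := fun k => slope u (k + (j + r)) + c) hv ?_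
    intro x k
    rw [hV, ← sub_le_iff_le_add (a := x), ← hu (x - c) (k + (j + r)), sub_le_iff_le_add]
  exact ⟨key hf hh e, key hf' hh' e'⟩

/-! ### Tridiagonal matrices -/

/-- The symmetric tridiagonal matrix with diagonal entries `p i + p (i + 1) + 2 * μ i` and
off-diagonal entries `- p (i + 1)`. -/
noncomputable def tridiag (g : ℕ) (p μ : ℕ → ℝ) : Matrix (Fin g) (Fin g) ℝ :=
  fun i j =>
    if i = j then p (i : ℕ) + p ((i : ℕ) + 1) + 2 * μ i
    else if (j : ℕ) = (i : ℕ) + 1 then - p ((i : ℕ) + 1)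
    else if (i : ℕ) = (j : ℕ) + 1 then - p ((j : ℕ) + 1)
    else 0

/-- The first entry of a vector, or `0` if there is none. -/
noncomputable def firstEntry {g : ℕ} (v : Fin g → ℝ) : ℝ :=
  ∑ i : Fin g, if (i : ℕ) = 0 then v i else 0

theorem firstEntry_succ {g : ℕ} (v : Fin (g + 1) → ℝ) :
    firstEntry v = v 0 := by
  simp [firstEntry]

theorem tridiag_transpose (g : ℕ) (p μ : ℕ → ℝ) : (tridiag g p μ)ᵀ = tridiag g p μ := by
  ext i j
  simp only [Matrix.transpose_apply, tridiag]
  by_cases h : i = j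
  · subst h; rfl
  · have h' : j ≠ i := fun e => h e.symm
    rw [if_neg h, if_neg h']
    split_ifs <;> first | rfl | omega

theorem tridiag_succ_succ (g : ℕ) (p μ : ℕ → ℝ) (i j : Fin g) :
    tridiag (g + 1) p μ i.succ j.succ
      = tridiag g (fun i => p (i + 1)) (fun i => μ (i + 1)) i j := by
  simp [tridiag]

theorem vecMul_tridiag_zero (g : ℕ) (p μ : ℕ → ℝ) (v : Fin (g + 1) → ℝ) :
    (v ᵥ* tridiag (g + 1) p μ) 0
      = (p 0 + p 1 + 2 * μ 0) * v 0 - p 1 * firstEntry (fun i => v i.succ) := by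
  simp only [Matrix.vecMul, dotProduct, Fin.sum_univ_succ, firstEntry, Finset.mul_sum]
  rw [sub_eq_add_neg, ← Finset.sum_neg_distrib]
  congr 1
  · simp [tridiag]; ring
  · refine Finset.sum_congr rfl fun i _ => ?_
    by_cases h : (i : ℕ) = 0
    · simp [tridiag, h]; ring
    · simp [tridiag, h]

theorem vecMul_tridiag_succ (g : ℕ) (p μ : ℕ → ℝ) (v : Fin (g + 1) → ℝ) (i : Fin g) :
    (v ᵥ* tridiag (g + 1) p μ) i.succ
      = ((fun i => v i.succ) ᵥ* tridiag g (fun i => p (i + 1)) (fun i => μ (i + 1))) i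
        - if (i : ℕ) = 0 then p 1 * v 0 else 0 := by
  simp only [Matrix.vecMul, dotProduct, Fin.sum_univ_succ, tridiag_succ_succ]
  rw [add_comm, sub_eq_add_neg]
  congr 1
  by_cases h : (i : ℕ) = 0
  · simp [tridiag, h, (Fin.succ_ne_zero i).symm]; ring
  · simp [tridiag, h, (Fin.succ_ne_zero i).symm]

theorem quadratic_form_succ (g : ℕ) (p μ : ℕ → ℝ) (v : Fin (g + 1) → ℝ) :
    v ⬝ᵥ (tridiag (g + 1) p μ *ᵥ v)
      = (p 0 + p 1 + 2 * μ 0) * v 0 ^ 2 - 2 * p 1 * v 0 * firstEntry (fun i => v i.succ)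
        + (fun i => v i.succ) ⬝ᵥ
          (tridiag g (fun i => p (i + 1)) (fun i => μ (i + 1)) *ᵥ fun i => v i.succ) := by
  rw [Matrix.dotProduct_mulVec, Matrix.dotProduct_mulVec, dotProduct, Fin.sum_univ_succ]
  simp only [vecMul_tridiag_zero, vecMul_tridiag_succ, sub_mul, Finset.sum_sub_distrib]
  have : ∑ i : Fin g, (if (i : ℕ) = 0 then p 1 * v 0 else 0) * v i.succ
      = p 1 * v 0 * firstEntry (fun i => v i.succ) := by
    rw [firstEntry, Finset.mul_sum]
    refine Finset.sum_congr rfl fun i _ => ?_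
    split_ifs <;> simp
  rw [this, dotProduct]
  ring

/-! ### The theta function as a chain minimum -/

/-- The energy of the integer vector `m` in the definition of `theta`. -/
noncomputable def energy {g : ℕ} (K : Matrix (Fin g) (Fin g) ℝ) (Z : Fin g → ℝ)
    (m : Fin g → ℤ) : ℝ :=
  (1 / 2 : ℝ) * (intVec m ⬝ᵥ (K *ᵥ intVec m)) + intVec m ⬝ᵥ Z

/-- Completing the square at the first site: of half its diagonal entry, `p 0 / 2` goes to the
coupling with `n`, `p 1 / 2` to the coupling with the next site and `μ 0` to the potential. The
first site then acts as the left end of the remaining chain. -/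
theorem energy_succ (g : ℕ) (p μ : ℕ → ℝ) (w : Fin (g + 1) → ℝ) (n : ℤ)
    (m : Fin (g + 1) → ℤ) :
    p 0 / 2 * (n : ℝ) ^ 2 - p 0 * n * firstEntry (intVec m) + energy (tridiag (g + 1) p μ) w m
      = quad (p 0) (n - m 0) + (μ 0 * (m 0 : ℝ) ^ 2 + w 0 * m 0
        + (p 1 / 2 * (m 0 : ℝ) ^ 2 - p 1 * m 0 * firstEntry (intVec fun i => m i.succ)
          + energy (tridiag g (fun i => p (i + 1)) (fun i => μ (i + 1)))
            (fun i => w i.succ) fun i => m i.succ)) := by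
  simp only [energy, quadratic_form_succ, firstEntry_succ, quad]
  have hv : (fun i : Fin g => intVec m i.succ) = intVec fun i => m i.succ := rfl
  have h0 : intVec m 0 = (m 0 : ℝ) := rfl
  have hw : intVec m ⬝ᵥ w
      = m 0 * w 0 + (intVec fun i => m i.succ) ⬝ᵥ fun i => w i.succ := by
    simp [dotProduct, Fin.sum_univ_succ, intVec]
  rw [hv, h0, hw]
  push_cast
  ring

theorem chainMin_isLeast (g : ℕ) (p μ : ℕ → ℝ) (w : Fin g → ℝ)
    (hp : ∀ i ≤ g, 0 < p i) (hμ : ∀ i < g, 0 < μ i) (n : ℤ) :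
    IsLeast (Set.range fun m : Fin g → ℤ =>
      p 0 / 2 * (n : ℝ) ^ 2 - p 0 * n * firstEntry (intVec m) + energy (tridiag g p μ) w m)
      (chainMin g p μ w n) := by
  induction g generalizing p μ n with
  | zero =>
    refine ⟨⟨0, ?_⟩, ?_⟩
    · simp [chainMin, quad, energy, firstEntry]
    · rintro _ ⟨m, rfl⟩
      simp [chainMin, quad, energy, firstEntry]
  | succ g ih =>
    have hp' : ∀ i ≤ g, 0 < p (i + 1) := fun i hi => hp _ (by omega)
    have hμ' : ∀ i < g, 0 < μ (i + 1) := fun i hi => hμ _ (by omega)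
    have ih' := ih (fun i => p (i + 1)) (fun i => μ (i + 1)) (fun i => w i.succ) hp' hμ'
    obtain ⟨N, hN⟩ := exists_galoisConnection_chainMin g (fun i => p (i + 1))
      (fun i => μ (i + 1)) (fun i => w i.succ) hp' hμ'
    obtain ⟨M, hM⟩ := exists_galoisConnection_addPotential (hμ 0 (by omega)) (w 0) hN
    obtain ⟨D, hD⟩ := exists_galoisConnection_quad (hp 0 (by omega))
    obtain ⟨⟨m₀, hm₀⟩, hle⟩ := infConv_isLeast hD hM n
    simp only [energy_succ]
    constructor
    · obtain ⟨m', hm'⟩ := (ih' m₀).1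
      refine ⟨Fin.cons m₀ m', ?_⟩
      simp only at hm' hm₀
      simp only [Fin.cons_zero, Fin.cons_succ]
      rw [chainMin, ← hm₀, addPotential, ← hm']
    · rintro _ ⟨m, rfl⟩
      have h1 := hle ⟨m 0, rfl⟩
      have h2 := (ih' (m 0)).2 ⟨fun i => m i.succ, rfl⟩
      rw [chainMin]
      refine h1.trans ?_
      simp only [addPotential]
      simp only at h2
      linarith

theorem theta_isLeast (g : ℕ) (p μ : ℕ → ℝ) (Z : Fin g → ℝ)
    (hp : ∀ i ≤ g, 0 < p i) (hμ : ∀ i < g, 0 < μ i) :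
    IsLeast (Set.range (energy (tridiag g p μ) Z)) (theta (tridiag g p μ) Z) := by
  have h := chainMin_isLeast g p μ Z hp hμ 0
  simp only [Int.cast_zero, mul_zero, zero_mul, sub_zero, zero_add, ne_eq, OfNat.ofNat_ne_zero,
    not_false_eq_true, zero_pow] at h
  have e : theta (tridiag g p μ) Z = chainMin g p μ Z 0 := h.csInf_eq
  rw [e]
  exact h

theorem dotProduct_first {g : ℕ} (v : Fin g → ℝ) (x : ℝ) :
    v ⬝ᵥ (fun i => if (i : ℕ) = 0 then x else 0) = firstEntry v * x := by
  rw [dotProduct, firstEntry, Finset.sum_mul]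
  refine Finset.sum_congr rfl fun i _ => ?_
  split_ifs <;> simp

/-- The shift of `w` contributes `-p 0 * n` times the first entry of `m`, which is the cross term of
the coupling with a left end at `n`. -/
theorem theta_eq_chainMin (g : ℕ) (p μ : ℕ → ℝ) (w : Fin g → ℝ)
    (hp : ∀ i ≤ g, 0 < p i) (hμ : ∀ i < g, 0 < μ i) (n : ℤ) :
    theta (tridiag g p μ) (w - fun i : Fin g => if (i : ℕ) = 0 then (n : ℝ) * p 0 else 0)
      = chainMin g p μ w n - quad (p 0) n := by
  have h := chainMin_isLeast g p μ w hp hμ n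
  have e : ∀ m : Fin g → ℤ,
      energy (tridiag g p μ) (w - fun i : Fin g => if (i : ℕ) = 0 then (n : ℝ) * p 0 else 0) m
        = energy (tridiag g p μ) w m - p 0 * n * firstEntry (intVec m) := by
    intro m
    rw [energy, energy, dotProduct_sub, dotProduct_first]
    ring
  refine (theta_isLeast g p μ _ hp hμ).unique ⟨?_, ?_⟩
  · obtain ⟨m, hm⟩ := h.1
    refine ⟨m, ?_⟩
    rw [e, quad, ← hm]
    ring
  · rintro _ ⟨m, rfl⟩
    have h2 := h.2 ⟨m, rfl⟩
    simp only at h2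
    rw [e, quad]
    linarith

/-- Quasi-periodicity of the theta function. -/
theorem theta_add_lattice (g : ℕ) (p μ : ℕ → ℝ) (Z : Fin g → ℝ)
    (hp : ∀ i ≤ g, 0 < p i) (hμ : ∀ i < g, 0 < μ i) (l : Fin g → ℤ) :
    theta (tridiag g p μ) (Z + intVec l ᵥ* tridiag g p μ)
      = theta (tridiag g p μ) Z - energy (tridiag g p μ) Z l := by
  -- Symmetry of the matrix turns the added linear term into the cross term of the quadratic form at
  -- `m + l`.
  have e : ∀ m, energy (tridiag g p μ) (Z + intVec l ᵥ* tridiag g p μ) m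
      = energy (tridiag g p μ) Z (m + l) - energy (tridiag g p μ) Z l := by
    intro m
    have h1 : intVec (m + l) = intVec m + intVec l := by ext i; simp [intVec]
    have h2 : intVec l ⬝ᵥ (tridiag g p μ *ᵥ intVec m)
        = intVec m ⬝ᵥ (intVec l ᵥ* tridiag g p μ) := by
      rw [Matrix.dotProduct_mulVec, dotProduct_comm]
    have h3 : intVec m ⬝ᵥ (tridiag g p μ *ᵥ intVec l)
        = intVec m ⬝ᵥ (intVec l ᵥ* tridiag g p μ) := by
      rw [← Matrix.mulVec_transpose, tridiag_transpose]
    simp only [energy, h1, Matrix.mulVec_add, dotProduct_add, add_dotProduct, h2, h3]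
    ring
  have h := theta_isLeast g p μ Z hp hμ
  refine (theta_isLeast g p μ _ hp hμ).unique ⟨?_, ?_⟩
  · obtain ⟨m, hm⟩ := h.1
    exact ⟨m - l, by rw [e, sub_add_cancel, hm]⟩
  · rintro _ ⟨m, rfl⟩
    rw [e]
    exact sub_le_sub_right (h.2 ⟨m + l, rfl⟩) _

/-! ### Injectivity -/

/-- The slopes of the chain minima for two potentials `w` and `w + μ` determine `w` up to the
period lattice. -/
theorem exists_lattice_of_slopes (g : ℕ) (p μ : ℕ → ℝ) (w w' : Fin g → ℝ)
    (hp : ∀ i ≤ g, 0 < p i) (hμ : ∀ i < g, 0 < μ i) (j : ℤ) (c : ℝ)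
    (e : ∀ k, slope (chainMin g p μ w') k = slope (chainMin g p μ w) (k + j) + c)
    (e' : ∀ k, slope (chainMin g p μ fun i => w' i + μ i) k
      = slope (chainMin g p μ fun i => w i + μ i) (k + j) + c) :
    ∃ l : Fin g → ℤ, c = p 0 * (firstEntry (intVec l) - j) ∧
      ∀ i, w' i - w i = (intVec l ᵥ* tridiag g p μ) i
        - if (i : ℕ) = 0 then p 0 * j else 0 := by
  induction g generalizing p μ j c with
  | zero =>
    refine ⟨0, ?_, fun i => i.elim0⟩
    have h := e 0
    simp only [chainMin, slope_quad] at h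
    push_cast at h
    simp only [firstEntry, Finset.univ_eq_empty, Finset.sum_empty]
    linarith
  | succ g ih =>
    have hp' : ∀ i ≤ g, 0 < p (i + 1) := fun i hi => hp _ (by omega)
    have hμ' : ∀ i < g, 0 < μ (i + 1) := fun i hi => hμ _ (by omega)
    have hgc : ∀ (u : Fin g → ℝ) (x : ℝ), ∃ M : ℝ → ℤ, GaloisConnection M
        (slope (addPotential (μ 0) x
          (chainMin g (fun i => p (i + 1)) (fun i => μ (i + 1)) u))) := by
      intro u x
      obtain ⟨N, hN⟩ := exists_galoisConnection_chainMin g (fun i => p (i + 1))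
        (fun i => μ (i + 1)) u hp' hμ'
      exact exists_galoisConnection_addPotential (hμ 0 (by omega)) x hN
    obtain ⟨N, hN⟩ := hgc (fun i => w i.succ) (w 0)
    obtain ⟨N', hN'⟩ := hgc (fun i => w i.succ + μ (i + 1)) (w 0 + μ 0)
    obtain ⟨M, hM⟩ := hgc (fun i => w' i.succ) (w' 0)
    obtain ⟨M', hM'⟩ := hgc (fun i => w' i.succ + μ (i + 1)) (w' 0 + μ 0)
    have hs := addPotential_strict (hμ 0 (by omega)) (w' 0)
      (interlace_chainMin g (fun i => p (i + 1)) (fun i => μ (i + 1)) (fun i => w' i.succ)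
        hp' hμ')
    obtain ⟨r, hr, h, h'⟩ := unmerge (hp 0 (by omega)) hN hN' hM hM' hs e e'
    -- Removing the potentials from both sides: the index shift `j + r` contributes `2 * μ 0 * (j +
    -- r)` to the constant.
    have hstep : ∀ k, slope (chainMin g (fun i => p (i + 1)) (fun i => μ (i + 1))
          fun i => w' i.succ) k
        = slope (chainMin g (fun i => p (i + 1)) (fun i => μ (i + 1)) fun i => w i.succ)
            (k + (j + r)) + (c + 2 * μ 0 * (j + r) + w 0 - w' 0) := by
      intro k
      have := h k
      simp only [slope_addPotential] at this
      push_cast at this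
      linarith
    have hstep' : ∀ k, slope (chainMin g (fun i => p (i + 1)) (fun i => μ (i + 1))
          fun i => w' i.succ + μ (i + 1)) k
        = slope (chainMin g (fun i => p (i + 1)) (fun i => μ (i + 1))
            fun i => w i.succ + μ (i + 1))
            (k + (j + r)) + (c + 2 * μ 0 * (j + r) + w 0 - w' 0) := by
      intro k
      have := h' k
      simp only [slope_addPotential] at this
      push_cast at this
      linarith
    obtain ⟨l, hl, hl'⟩ := ih (fun i => p (i + 1)) (fun i => μ (i + 1)) (fun i => w i.succ)
      (fun i => w' i.succ) hp' hμ' (j + r) _ hstep hstep'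
    have htail : (fun i : Fin g => intVec (Fin.cons (j + r) l : Fin (g + 1) → ℤ) i.succ)
        = intVec l := by ext i; simp [intVec]
    have hhead : intVec (Fin.cons (j + r) l : Fin (g + 1) → ℤ) 0 = (j : ℝ) + r := by
      simp [intVec]
    -- The new lattice coordinate is the index shift accumulated so far. The formula for the
    -- constant of the shorter chain, `hl`, then yields the coordinate of `w' - w` at the first
    -- site.
    refine ⟨Fin.cons (j + r) l, ?_, fun i => ?_⟩
    · rw [firstEntry_succ, hhead, hr]
      ring
    · refine Fin.cases ?_ (fun i => ?_) i
      · rw [vecMul_tridiag_zero, htail, hhead]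
        push_cast at hl
        simp only [if_true, Fin.coe_ofNat_eq_mod, Nat.zero_mod] at hl ⊢
        rw [hr] at hl
        linarith
      · rw [vecMul_tridiag_succ, htail, hhead]
        have := hl' i
        push_cast at this
        rw [this]
        simp

/-! ### The period in `n` -/

/-- With `v i = g - i`, an inner entry is `-p i + p (i + 1) + 2 * μ i * v i`, which `h` makes
vanish. At the first site the missing left neighbour, of would-be value `g + 1`, leaves `(g + 1) * p
0`. -/
theorem vecMul_descending (g : ℕ) (p μ : ℕ → ℝ)
    (h : ∀ i < g, p i - p (i + 1) = 2 * ((g : ℝ) - i) * μ i) (i : Fin g) :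
    ((fun j : Fin g => (g : ℝ) - (j : ℕ)) ᵥ* tridiag g p μ) i
      = if (i : ℕ) = 0 then ((g : ℝ) + 1) * p 0 else 0 := by
  induction g generalizing p μ with
  | zero => exact i.elim0
  | succ g ih =>
    have htail : (fun i : Fin g => ((g + 1 : ℕ) : ℝ) - ((i.succ : Fin (g + 1)) : ℕ))
        = fun j : Fin g => (g : ℝ) - (j : ℕ) := by
      ext j; push_cast [Fin.val_succ]; ring
    refine Fin.cases ?_ (fun i => ?_) i
    · rw [vecMul_tridiag_zero, htail]
      have h0 := h 0 (by omega)
      -- For `g = 0` the vector is empty and both sides vanish.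
      have hf : p 1 * firstEntry (fun j : Fin g => (g : ℝ) - (j : ℕ)) = p 1 * g := by
        cases g with
        | zero => simp [firstEntry]
        | succ g => rw [firstEntry_succ]; simp
      rw [hf]
      push_cast at h0 ⊢
      simp only [sub_zero, Fin.val_zero, Nat.cast_zero, if_true] at h0 ⊢
      linarith
    · rw [vecMul_tridiag_succ, htail, ih]
      · simp only [Fin.val_succ, Nat.add_eq_zero_iff, one_ne_zero, and_false, if_false,
          Fin.val_zero]
        split_ifs
        · push_cast; ring
        · ring
      · intro i hi
        have := h (i + 1) (by omega)
        push_cast at this ⊢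
        linarith

/-! ### The coefficients of the period matrix -/

theorem lam_zero (g : ℕ) (C : ℤ → ℝ) : lam g C 0 = C g := by simp [lam]

theorem lam_succ (g : ℕ) (C : ℤ → ℝ) (i : ℕ) :
    lam g C (i + 1) = C ((g : ℤ) - i - 1) - C ((g : ℤ) - i) := by
  simp only [lam, Nat.succ_ne_zero, if_false]
  push_cast
  congr 2 <;> ring

/-- The gap `λ_{i+1} - λ_i`. -/
def gap (g : ℕ) (C : ℤ → ℝ) (i : ℕ) : ℝ := lam g C (i + 1) - lam g C i

theorem gap_pos {g : ℕ} {C : ℤ → ℝ} (hC : Generic g C) (i : ℕ) (hi : i < g) :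
    0 < gap g C i := by
  obtain ⟨-, h2, h3⟩ := hC
  cases i with
  | zero =>
    rw [gap, lam_succ, lam_zero]
    simp only [Nat.cast_zero, sub_zero]
    linarith
  | succ i =>
    have := h2 ((g : ℤ) - i - 2) (by omega) (by omega)
    rw [gap, lam_succ, lam_succ]
    rw [show (g : ℤ) - i - 2 + 2 = g - i by ring,
      show (g : ℤ) - i - 2 + 1 = g - i - 1 by ring] at this
    push_cast
    rw [show (g : ℤ) - (i + 1) - 1 = g - i - 2 by ring,
      show (g : ℤ) - (i + 1) = g - i - 1 by ring]
    linarith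

theorem lam_le_lam {g : ℕ} {C : ℤ → ℝ} (hC : Generic g C) {i j : ℕ} (hij : i ≤ j)
    (hj : j ≤ g) : lam g C i ≤ lam g C j := by
  induction j, hij using Nat.le_induction with
  | base => exact le_rfl
  | succ j hij ih =>
    have := gap_pos hC j (by omega)
    rw [gap] at this
    linarith [ih (by omega)]

/-- As `λ_0` is the smallest, all minima vanish at `i = 0`, so that index needs no separate
treatment. -/
theorem pcoef_eq {g : ℕ} {C : ℤ → ℝ} (hC : Generic g C) (i : ℕ) :
    pcoef g C i = bigL g C
      - 2 * ∑ j ∈ Finset.Icc 1 g, min (lam g C i - lam g C 0) (lam g C j - lam g C 0) := by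
  by_cases h : i = 0
  · subst h
    rw [pcoef, if_pos rfl, Finset.sum_eq_zero]
    · ring
    · intro j hj
      rw [Finset.mem_Icc] at hj
      have := lam_le_lam hC (Nat.zero_le j) hj.2
      rw [sub_self, min_eq_left (by linarith)]
  · rw [pcoef, if_neg h]

/-- Raising `λ_i` to `λ_{i+1}` increases the minimum by the gap for the `g - i` indices `j > i` and
leaves the others unchanged. -/
theorem pcoef_sub {g : ℕ} {C : ℤ → ℝ} (hC : Generic g C) (i : ℕ) (hi : i < g) :
    pcoef g C i - pcoef g C (i + 1) = 2 * ((g : ℝ) - i) * gap g C i := by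
  have key : ∑ j ∈ Finset.Icc 1 g, (min (lam g C (i + 1) - lam g C 0) (lam g C j - lam g C 0)
      - min (lam g C i - lam g C 0) (lam g C j - lam g C 0)) = ((g : ℝ) - i) * gap g C i := by
    have hsub : Finset.Icc (i + 1) g ⊆ Finset.Icc 1 g := Finset.Icc_subset_Icc_left (by omega)
    rw [← Finset.sum_subset hsub]
    · have hc : ((Finset.Icc (i + 1) g).card : ℝ) = (g : ℝ) - i := by
        rw [Nat.card_Icc, Nat.cast_sub (by omega)]
        push_cast
        ring
      rw [← hc, ← nsmul_eq_mul]
      refine Finset.sum_eq_card_nsmul fun j hj => ?_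
      rw [Finset.mem_Icc] at hj
      have h1 := lam_le_lam hC hj.1 hj.2
      have h2 := lam_le_lam hC (show i ≤ j by omega) hj.2
      rw [min_eq_left (by linarith), min_eq_left (by linarith), gap]
      ring
    · intro j hj hj'
      rw [Finset.mem_Icc] at hj hj'
      have h1 := lam_le_lam hC (show j ≤ i by omega) (by omega)
      have h2 := lam_le_lam hC (show j ≤ i + 1 by omega) (by omega)
      rw [min_eq_right (by linarith), min_eq_right (by linarith), sub_self]
  rw [Finset.sum_sub_distrib] at key
  rw [pcoef_eq hC, pcoef_eq hC]
  linarith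

theorem sum_lam (g : ℕ) (C : ℤ → ℝ) (n : ℕ) :
    ∑ j ∈ Finset.Icc 1 n, lam g C j = C ((g : ℤ) - n) - C g := by
  induction n with
  | zero => simp
  | succ n ih =>
    rw [Finset.sum_Icc_succ_top (by omega), ih, lam_succ]
    push_cast
    rw [show (g : ℤ) - (n + 1) = g - n - 1 by ring]
    ring

/-- Every minimum is attained by the `j`-th term, and the sum of the `λ_j` telescopes. Positivity of
all `p_i` follows from this one, since they decrease in `i`. -/
theorem pcoef_top {g : ℕ} {C : ℤ → ℝ} (hC : Generic g C) :
    pcoef g C g = C (-1) - 2 * C 0 := by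
  rw [pcoef_eq hC]
  have : ∑ j ∈ Finset.Icc 1 g, min (lam g C g - lam g C 0) (lam g C j - lam g C 0)
      = ∑ j ∈ Finset.Icc 1 g, (lam g C j - lam g C 0) := by
    refine Finset.sum_congr rfl fun j hj => min_eq_right ?_
    rw [Finset.mem_Icc] at hj
    linarith [lam_le_lam hC hj.2 le_rfl]
  rw [this, Finset.sum_sub_distrib, sum_lam, Finset.sum_const, Nat.card_Icc, lam_zero, bigL]
  simp
  ring

theorem pcoef_pos {g : ℕ} {C : ℤ → ℝ} (hC : Generic g C) (i : ℕ) (hi : i ≤ g) :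
    0 < pcoef g C i := by
  induction hi using Nat.decreasingInduction with
  | self =>
    rw [pcoef_top hC]
    linarith [hC.1]
  | of_succ i hi ih =>
    have h1 := pcoef_sub hC i hi
    have h2 : 0 < (g : ℝ) - i := sub_pos.mpr (by exact_mod_cast hi)
    have := mul_pos h2 (gap_pos hC i hi)
    linarith

theorem periodMatrix_eq_tridiag (g : ℕ) (C : ℤ → ℝ) :
    periodMatrix g C = tridiag g (pcoef g C) (gap g C) := rfl

theorem pcoef_zero (g : ℕ) (C : ℤ → ℝ) : pcoef g C 0 = bigL g C := by simp [pcoef]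

/-- The increments `μ = gap` are also the entries of `λ⃗`, so one step in `s` is exactly the move `w
↦ w + μ` that makes slopes interlace. -/
theorem theta_zPoint {g : ℕ} {C : ℤ → ℝ} (hC : Generic g C) (Z : Fin g → ℝ) (n s : ℤ) :
    theta (periodMatrix g C) (zPoint g C Z n s)
      = chainMin g (pcoef g C) (gap g C) (fun i => Z i + s * gap g C i) n
        - quad (pcoef g C 0) n := by
  rw [← theta_eq_chainMin g _ _ _ (pcoef_pos hC) (gap_pos hC), periodMatrix_eq_tridiag]
  congr 1
  ext i
  simp only [zPoint, lamVec, gap, Pi.sub_apply, pcoef_zero]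
  ring

theorem zPoint_eq (g : ℕ) (C : ℤ → ℝ) (Z : Fin g → ℝ) (n s : ℤ) :
    zPoint g C Z n s = Z - (fun i : Fin g => if (i : ℕ) = 0 then (n : ℝ) * bigL g C else 0)
      + (s : ℝ) • lamVec g C := by
  ext i
  simp [zPoint]

theorem energy_zPoint (g : ℕ) (C : ℤ → ℝ) (Z : Fin g → ℝ) (n s : ℤ) (l : Fin g → ℤ) :
    energy (periodMatrix g C) (zPoint g C Z n s) l
      = energy (periodMatrix g C) Z l - firstEntry (intVec l) * bigL g C * n
        + (intVec l ⬝ᵥ lamVec g C) * s := by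
  rw [energy, energy, zPoint_eq, dotProduct_add, dotProduct_sub, dotProduct_smul,
    dotProduct_first, smul_eq_mul]
  ring

theorem theta_zPoint_add {g : ℕ} {C : ℤ → ℝ} (hC : Generic g C) (Z : Fin g → ℝ)
    (l : Fin g → ℤ) (n s : ℤ) :
    theta (periodMatrix g C) (zPoint g C Z n s + intVec l ᵥ* periodMatrix g C)
      = theta (periodMatrix g C) (zPoint g C Z n s)
        + (firstEntry (intVec l) * bigL g C * n + -(intVec l ⬝ᵥ lamVec g C) * s
          + -energy (periodMatrix g C) Z l) := by
  rw [periodMatrix_eq_tridiag, theta_add_lattice g _ _ _ (pcoef_pos hC) (gap_pos hC),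
    ← periodMatrix_eq_tridiag, energy_zPoint]
  ring

theorem zPoint_add (g : ℕ) (C : ℤ → ℝ) (Z v : Fin g → ℝ) (n s : ℤ) :
    zPoint g C (Z + v) n s = zPoint g C Z n s + v := by
  rw [zPoint_eq, zPoint_eq]
  abel

theorem zPoint_period {g : ℕ} {C : ℤ → ℝ} (hC : Generic g C) (Z : Fin g → ℝ) (n s : ℤ) :
    zPoint g C Z (n + g + 1) s = zPoint g C Z n s
      + intVec (fun i : Fin g => -((g : ℤ) - (i : ℕ))) ᵥ* periodMatrix g C := by
  have h : intVec (fun i : Fin g => -((g : ℤ) - (i : ℕ)))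
      = -fun j : Fin g => (g : ℝ) - (j : ℕ) := by
    ext i; simp [intVec]
  rw [h, Matrix.neg_vecMul, periodMatrix_eq_tridiag]
  ext i
  rw [Pi.add_apply, Pi.neg_apply, vecMul_descending g _ _ (pcoef_sub hC), pcoef_zero]
  simp only [zPoint]
  split_ifs
  · push_cast; ring
  · ring

theorem iota_mem_tauPairs {g : ℕ} {C : ℤ → ℝ} (hC : Generic g C) (t : ℤ) (Z : Fin g → ℝ) :
    iota g C t Z ∈ tauPairs g t := by
  set l : Fin g → ℤ := fun i => -((g : ℤ) - (i : ℕ)) with hl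
  refine ⟨firstEntry (intVec l) * bigL g C, -(intVec l ⬝ᵥ lamVec g C),
    -energy (periodMatrix g C) Z l, fun n => ⟨?_, ?_⟩⟩
  · simp only [iota]
    rw [zPoint_period hC, theta_zPoint_add hC]
  · simp only [iota]
    rw [zPoint_period hC, theta_zPoint_add hC]
    push_cast
    rfl

theorem affineEquivalent_add_lattice {g : ℕ} {C : ℤ → ℝ} (hC : Generic g C) (t : ℤ)
    (Z : Fin g → ℝ) (l : Fin g → ℤ) :
    AffineEquivalent t (iota g C t Z) (iota g C t (Z + intVec l ᵥ* periodMatrix g C)) := by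
  refine ⟨firstEntry (intVec l) * bigL g C, -(intVec l ⬝ᵥ lamVec g C),
    -energy (periodMatrix g C) Z l, fun n => ⟨?_, ?_⟩⟩
  · simp only [iota]
    rw [zPoint_add, theta_zPoint_add hC]
  · simp only [iota]
    rw [zPoint_add, theta_zPoint_add hC]
    push_cast
    rfl

theorem sub_mem_of_affineEquivalent {g : ℕ} {C : ℤ → ℝ} (hC : Generic g C) (t : ℤ)
    {Z Z' : Fin g → ℝ} (h : AffineEquivalent t (iota g C t Z) (iota g C t Z')) :
    Z' - Z ∈ periodLattice (periodMatrix g C) := by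
  obtain ⟨α, β, γ, h⟩ := h
  simp only [iota, theta_zPoint hC] at h
  have hw : ∀ Y : Fin g → ℝ, (fun i : Fin g => Y i + ((t + 1 : ℤ) : ℝ) * gap g C i)
      = fun i : Fin g => Y i + t * gap g C i + gap g C i := by
    intro Y; ext i; push_cast; ring
  simp only [hw] at h
  -- Differences in `n` remove `β` and `γ`, and the quadratic terms cancel; the slopes differ by the
  -- constant `α` with no index shift, hence `j = 0`.
  obtain ⟨l, -, hl⟩ := exists_lattice_of_slopes g (pcoef g C) (gap g C)
    (fun i => Z i + t * gap g C i) (fun i => Z' i + t * gap g C i)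
    (pcoef_pos hC) (gap_pos hC) 0 α
    (fun k => by
      have h1 := (h (k + 1)).1
      have h2 := (h k).1
      push_cast at h1
      simp only [slope, add_zero]
      linarith)
    (fun k => by
      have h1 := (h (k + 1)).2
      have h2 := (h k).2
      push_cast at h1
      simp only [slope, add_zero]
      linarith)
  refine ⟨l, ?_⟩
  ext i
  have := hl i
  simp only [Int.cast_zero, mul_zero, ite_self, sub_zero, add_sub_add_right_eq_sub] at this
  rw [Pi.sub_apply, this, periodMatrix_eq_tridiag]

theorem affineEquivalent_iff {g : ℕ} {C : ℤ → ℝ} (hC : Generic g C) (t : ℤ)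
    (Z Z' : Fin g → ℝ) :
    AffineEquivalent t (iota g C t Z) (iota g C t Z') ↔
      (QuotientAddGroup.mk Z : TropicalJacobian (periodMatrix g C)) = QuotientAddGroup.mk Z' := by
  rw [QuotientAddGroup.eq, neg_add_eq_sub]
  refine ⟨sub_mem_of_affineEquivalent hC t, ?_⟩
  rintro ⟨l, hl⟩
  rw [sub_eq_iff_eq_add'] at hl
  rw [hl]
  exact affineEquivalent_add_lattice hC t Z l

end UDToda

theorem proposition2p9 (g : ℕ) (hg : 0 < g) (C : ℤ → ℝ) (hC : UDToda.Generic g C) (t : ℤ) :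
    -- `ι_t` takes its values in `𝒮_t × 𝒮_{t+1}`
    (∀ Z : Fin g → ℝ, UDToda.iota g C t Z ∈ UDToda.tauPairs g t) ∧
    -- `ι_t` separates the points of `J(K)`
    (∀ Z Z' : Fin g → ℝ, UDToda.iota g C t Z = UDToda.iota g C t Z' →
      (QuotientAddGroup.mk Z : UDToda.TropicalJacobian (UDToda.periodMatrix g C)) =
        QuotientAddGroup.mk Z') ∧
    -- `ι_t` induces a well defined injective map from `J(K)` to `𝒮_t × 𝒮_{t+1}` modulo
    -- affine functions
    (∀ Z Z' : Fin g → ℝ,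
      UDToda.AffineEquivalent t (UDToda.iota g C t Z) (UDToda.iota g C t Z') ↔
      (QuotientAddGroup.mk Z : UDToda.TropicalJacobian (UDToda.periodMatrix g C)) =
        QuotientAddGroup.mk Z') :=
  ⟨UDToda.iota_mem_tauPairs hC t,
    fun Z Z' h => (UDToda.affineEquivalent_iff hC t Z Z').1
      ⟨0, 0, 0, fun n => by rw [h]; simp⟩,
    UDToda.affineEquivalent_iff hC t⟩
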